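/- Fix $M>0$, $\sigma>0$ and an integer $\bar K\ge 2$. Let $\mathfrak P$ be the class of stochastic bandit instances $\nu=(\nu_1,\dots,\nu_K)$ with $2\le K\le\bar K$ arms, where each reward distribution $\nu_i$ on $\mathbb R$ has mean $\mu_i\in[-M,M]$ and is $\sigma$-sub-Gaussian, i.e. $\mathbb E_{X\sim\nu_i}\,e^{s(X-\mu_i)}\le e^{\sigma^2s^2/2}$ for all $s\in\mathbb R$. A bandit algorithm specifies, for every number of arms $K\ge 2$ and every horizon $T$, decision rules $\pi_t(\cdot\mid A_1,r_1,\dots,A_{t-1},r_{t-1})$ that are probability distributions on $[K]=\{1,\dots,K\}$. In round $t\le T$ the arm $A_t$ is drawn from $\pi_t$ given the history, and the reward $r_t$ is a fresh independent draw from $\nu_{A_t}$. Let $N_{i,T}$ be the number of rounds $t\le T$ with $A_t=i$, and $$R_T(\nu)=\sum_{i=1}^K\Bigl(\max_{j}\mu_j-\mu_i\Bigr)\mathbb E[N_{i,T}],\qquad S_T(\nu)=\max_{i\in[K]}\sqrt{\operatorname{Var}(N_{i,T})},$$ $$\mathcal R_T=\sup_{\nu\in\mathfrak P}R_T(\nu),\qquad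 \mathcal S_T=\sup_{\nu\in\mathfrak P}S_T(\nu).$$ Consider any algorithm such that, for every $\nu\in\mathfrak P$ with $K$ arms and every $T\ge K$: (i) $\nu_i=\nu_j$ implies $\mathbb E[N_{i,T}]=\mathbb E[N_{j,T}]$; and (ii) $\mathbb E[N_{i,T}]\ge 1$ for every arm $i$. As $T\to\infty$: 1. If $\mathcal R_T=\tilde O(\sqrt T)$, that is, $\mathcal R_T=O(\sqrt T\,(\log T)^k)$ for some $k\in\mathbb N$, then the worst-case allocation variability satisfies $\mathcal S_T=\tilde\Theta(T)$, that is, for some $k'\in\mathbb N$, $\mathcal S_T=O(T(\log T)^{k'})$ and $T=O(\mathcal S_T(\log T)^{k'})$. 2. In particular, if $\mathcal R_T=\Theta(\sqrt T)$ (minimax regret-optimal algorithms), then $\mathcal S_T=\Theta(T)$. -/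

import Mathlib

open MeasureTheory ProbabilityTheory Filter Asymptotics
open scoped NNReal

noncomputable section

namespace Bandit

/-- The observed history after `t` rounds of a bandit with `K` arms: in each round the pulled arm
and the collected reward. -/
abbrev History (K t : ℕ) : Type := Fin t → Fin K × ℝ

/-- The decision rules of a (randomized) policy for `K` arms: given the history of the first `t`
rounds, the next arm is drawn from the distribution `rule t history` on the arms. -/
structure Policy (K : ℕ) where
  rule : (t : ℕ) → Kernel (History K t) (Fin K)
  markov : ∀ t, IsMarkovKernel (rule t)

/-- A bandit algorithm: decision rules for every number `K ≥ 2` of arms and every horizon `T`.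
The rules may depend on the horizon; anytime algorithms are those for which they do not. -/
def Algorithm : Type := (K : ℕ) → 2 ≤ K → (T : ℕ) → Policy K

/-- A stochastic bandit instance: `K ≥ 2` arms with their reward distributions. -/
structure Instance where
  K : ℕ
  two_le : 2 ≤ K
  arm : Fin K → Measure ℝ
  prob : ∀ i, IsProbabilityMeasure (arm i)

/-- The mean reward of an arm. -/
def Instance.mean (ν : Instance) (i : Fin ν.K) : ℝ := ∫ x, x ∂(ν.arm i)

/-- The mean reward of the best arm. -/
def Instance.bestMean (ν : Instance) : ℝ := ⨆ i, ν.mean i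

/-- The mean reward gap of an arm. -/
def Instance.gap (ν : Instance) (i : Fin ν.K) : ℝ := ν.bestMean - ν.mean i

/-- The class of instances with at most `Kbar` arms, means in `[-M, M]` and `σ`-sub-Gaussian
rewards, i.e. `E exp (s (X - μ)) ≤ exp (σ² s² / 2)` for all real `s`. -/
def subGaussianClass (M : ℝ) (σ : ℝ≥0) (Kbar : ℕ) : Set Instance :=
  {ν | ν.K ≤ Kbar ∧ ∀ i, ν.mean i ∈ Set.Icc (-M) M ∧
    HasSubgaussianMGF (fun x => x - ν.mean i) (σ ^ 2) (ν.arm i)}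

/-- The reward kernel of an instance: when arm `i` is pulled, a reward is drawn from the
distribution of arm `i`. -/
def Instance.rewardKernel (ν : Instance) : Kernel (Fin ν.K) ℝ := Kernel.ofFunOfCountable ν.arm

/-- The law of the first `t` rounds of the interaction of a policy with an instance: given the
history, the next arm `a` is drawn from the decision rule, and given the history and `a` the reward
is a fresh independent draw from the distribution of arm `a`. -/
def historyLaw (ν : Instance) (π : Policy ν.K) : (t : ℕ) → Measure (History ν.K t)
  | 0 => Measure.dirac Fin.elim0
  | t + 1 => ((historyLaw ν π t) ⊗ₘ
      ((π.rule t) ⊗ₖ (ν.rewardKernel.comap Prod.snd measurable_snd))).map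
        (fun p => (Fin.snoc p.1 p.2 : History ν.K (t + 1)))

/-- The number of pulls of arm `i` in a history. -/
def pullCount {K t : ℕ} (i : Fin K) (h : History K t) : ℕ :=
  (Finset.univ.filter fun s => (h s).1 = i).card

namespace Algorithm

/-- The law of the whole history of `T` rounds when the algorithm is run on `ν` with
horizon `T`. -/
def law (π : Algorithm) (ν : Instance) (T : ℕ) : Measure (History ν.K T) :=
  historyLaw ν (π ν.K ν.two_le T) T

/-- The expected number of pulls `E[N_{i,T}]`. -/
def expectedPulls (π : Algorithm) (ν : Instance) (T : ℕ) (i : Fin ν.K) : ℝ :=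
  ∫ h, (pullCount i h : ℝ) ∂(π.law ν T)

/-- The expected pseudo-regret `R_T(ν) = ∑ i, Δ_i E[N_{i,T}]`. -/
def regret (π : Algorithm) (ν : Instance) (T : ℕ) : ℝ :=
  ∑ i, ν.gap i * π.expectedPulls ν T i

/-- The allocation variability `S_T(ν)`: the largest standard deviation, over the arms, of the
number of pulls. -/
def allocationVariability (π : Algorithm) (ν : Instance) (T : ℕ) : ℝ :=
  ⨆ i : Fin ν.K, √(Var[fun h => (pullCount i h : ℝ); π.law ν T])

/-- The worst-case regret over a class of instances. -/
def worstRegret (π : Algorithm) (P : Set Instance) (T : ℕ) : ℝ :=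
  ⨆ ν : P, π.regret ν T

/-- The worst-case allocation variability over a class of instances. -/
def worstVariability (π : Algorithm) (P : Set Instance) (T : ℕ) : ℝ :=
  ⨆ ν : P, π.allocationVariability ν T

/-- The standing regularity conditions on algorithms: as soon as the horizon is at least the number
of arms, arms with the same reward distribution are pulled equally often in expectation, and each
arm is pulled at least once in expectation. -/
structure IsRegular (π : Algorithm) (P : Set Instance) : Prop where
  symm : ∀ ν ∈ P, ∀ T, ν.K ≤ T → ∀ i j, ν.arm i = ν.arm j →
    π.expectedPulls ν T i = π.expectedPulls ν T j
  one_le : ∀ ν ∈ P, ∀ T, ν.K ≤ T → ∀ i, 1 ≤ π.expectedPulls ν T i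

end Algorithm

/-- `a_T = Õ(b_T)`: `a_T = O(b_T (log T) ^ k)` for some `k`. -/
def SoftO (a b : ℕ → ℝ) : Prop :=
  ∃ k : ℕ, a =O[atTop] fun T => b T * Real.log T ^ k

/-- `a_T = Θ̃(b_T)`: `a_T = Õ(b_T)`, and `a_T = Ω̃(b_T)`, that is, `b_T = Õ(a_T)`. -/
def SoftTheta (a b : ℕ → ℝ) : Prop := SoftO a b ∧ SoftO b a

instance (ν : Instance) (i : Fin ν.K) : IsProbabilityMeasure (ν.arm i) := ν.prob i
instance (K : ℕ) (π : Policy K) (t : ℕ) : IsMarkovKernel (π.rule t) := π.markov t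
instance (ν : Instance) : IsMarkovKernel ν.rewardKernel := ⟨fun i => ν.prob i⟩

lemma measurable_snoc (K t : ℕ) : Measurable
    (fun p : History K t × (Fin K × ℝ) => (Fin.snoc p.1 p.2 : History K (t+1))) := by
  refine measurable_pi_iff.2 fun s => ?_
  refine Fin.lastCases ?_ (fun s => ?_) s
  · simpa using measurable_snd
  · simp only [Fin.snoc_castSucc]
    exact (measurable_pi_apply s).comp measurable_fst

instance (ν : Instance) (π : Policy ν.K) (t : ℕ) : IsProbabilityMeasure (historyLaw ν π t) := by
  induction t with
  | zero => unfold historyLaw; infer_instance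
  | succ t ih =>
    unfold historyLaw
    exact Measure.isProbabilityMeasure_map (measurable_snoc _ _).aemeasurable

instance (π : Algorithm) (ν : Instance) (T : ℕ) : IsProbabilityMeasure (π.law ν T) := by
  unfold Algorithm.law; infer_instance

lemma measurable_pullCount {K t : ℕ} (i : Fin K) : Measurable (fun h : History K t => (pullCount i h : ℝ)) := by
  have : (fun h : History K t => (pullCount i h : ℝ)) =
    fun h => ∑ s, if (h s).1 = i then 1 else 0 := by
    ext h; simp [pullCount]
  rw [this]
  refine Finset.measurable_sum _ fun s _ => ?_
  refine Measurable.ite ?_ measurable_const measurable_const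
  exact (measurable_fst.comp (measurable_pi_apply s)) (measurableSet_singleton i)

lemma pullCount_le {K t : ℕ} (i : Fin K) (h : History K t) : (pullCount i h : ℝ) ≤ t := by
  have := Finset.card_filter_le (Finset.univ : Finset (Fin t)) (fun s => (h s).1 = i)
  simp at this
  exact_mod_cast this

lemma integrable_pullCount (π : Algorithm) (ν : Instance) (T : ℕ) (i : Fin ν.K) :
    Integrable (fun h => (pullCount i h : ℝ)) (π.law ν T) :=
  Integrable.of_bound (measurable_pullCount i).aestronglyMeasurable T
    (.of_forall fun h => by simpa using pullCount_le i h)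

lemma sum_expectedPulls (π : Algorithm) (ν : Instance) (T : ℕ) : ∑ i, π.expectedPulls ν T i = T := by
  unfold Algorithm.expectedPulls
  rw [← integral_finsetSum _ fun i _ => integrable_pullCount π ν T i]
  have : ∀ h : History ν.K T, ∑ i, (pullCount i h : ℝ) = T := by
    intro h
    have := Finset.card_eq_sum_card_fiberwise (f := fun s => (h s).1)
      (s := (Finset.univ : Finset (Fin T))) (t := Finset.univ) (by simp)
    simp at this
    rw [← Nat.cast_sum]; congr 1; exact this.symm
  simp [this]

/-- The supremum that defines the worst-case allocation variability is one of a bounded set. -/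
lemma bddAbove_allocationVariability (π : Algorithm) (P : Set Instance) (T : ℕ) :
    BddAbove (Set.range fun ν : P => π.allocationVariability ν T) := by
  refine ⟨T, ?_⟩
  rintro _ ⟨ν, rfl⟩
  have : Nonempty (Fin ν.1.K) := ⟨⟨0, by have := ν.1.two_le; omega⟩⟩
  refine ciSup_le fun i => ?_
  rw [Real.sqrt_le_left (by positivity)]
  refine (variance_le_expectation_sq (measurable_pullCount i).aestronglyMeasurable).trans ?_
  calc _ ≤ ∫ h, (T:ℝ)^2 ∂(π.law ν T) := by
        refine integral_mono_of_nonneg (.of_forall fun h => sq_nonneg _) (integrable_const _)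
          (.of_forall fun h => ?_)
        have := pullCount_le i h
        simp only [Pi.pow_apply]; gcongr
    _ = _ := by simp

/-- The supremum that defines the worst-case regret is one of a bounded set. -/
lemma bddAbove_regret (π : Algorithm) (M : ℝ) (σ : ℝ≥0) (K T : ℕ) :
    BddAbove (Set.range fun ν : subGaussianClass M σ K => π.regret ν T) := by
  refine ⟨2 * M * T, ?_⟩
  rintro _ ⟨⟨ν, h1, h⟩, rfl⟩
  have : Nonempty (Fin ν.K) := ⟨⟨0, by have := ν.two_le; omega⟩⟩
  show π.regret ν T ≤ _
  unfold Algorithm.regret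
  rw [← sum_expectedPulls π ν T, Finset.mul_sum]
  gcongr with i
  · exact integral_nonneg fun h => by positivity
  · have : ν.bestMean ≤ M := ciSup_le fun j => (h j).1.2
    have := (h i).1.1
    unfold Instance.gap; linarith

end Bandit

end

/-! Fix T and let two Gaussian arms of variance σ² have means kδ and 0, with δ = σ/√T and k = 0, …,
L. At k = 0 the arms are identical, so symmetry gives the second arm T/2 expected pulls. At k = L
its gap is Lδ, and low regret forces this number down to T/4. One step of the chain shifts one mean
by δ, so the likelihood ratio of the whole T-round history has second moment at most e. By
Cauchy–Schwarz (`sq_integral_withDensity_sub_le`, `sq_expectedPulls_sub_le`), a step changes the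
expected pulls by at most √e standard deviations, hence by at most 2S, where S is the worst-case
variability. Telescoping gives T/4 ≤ 2LS (`natCast_le_mul_worstVariability`). Regret O(√T (log T)^k)
allows L of order (log T)^k, so L is bounded when k = 0. The upper bound S ≤ T is trivial, since
pull counts lie in [0, T]. -/

namespace Bandit
open scoped ENNReal

/-! ### Change of measure and variance -/

/-- The Hammersley–Chapman–Robbins inequality: if `Q` has a density with respect to `P` whose second
moment is at most `C`, then the means of `X` under `P` and `Q` differ by at most
`√(C * Var_P X)`. -/
lemma sq_integral_withDensity_sub_le {Ω : Type*} [MeasurableSpace Ω] {P Q : Measure Ω}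
    [IsProbabilityMeasure P] [IsProbabilityMeasure Q] {D : Ω → ℝ≥0∞} (hD : Measurable D)
    (hQ : Q = P.withDensity D) {C : ℝ} (hC : 0 < C) (hDC : ∫⁻ ω, D ω ^ 2 ∂P ≤ ENNReal.ofReal C)
    {X : Ω → ℝ} (hX : MemLp X 2 P) (hXQ : Integrable X Q) :
    (∫ ω, X ω ∂Q - ∫ ω, X ω ∂P) ^ 2 ≤ C * Var[X; P] := by
  have hfin : ∀ᵐ ω ∂P, D ω < ∞ := by
    filter_upwards [ae_lt_top (hD.pow_const 2) (hDC.trans_lt ENNReal.ofReal_lt_top).ne] with ω h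
    by_contra h'
    simp [not_lt_top_iff.1 h'] at h
  set Z : Ω → ℝ := fun ω => (D ω).toReal with hZ
  have hZm : Measurable Z := hD.ennreal_toReal
  have hsq : ∫⁻ ω, ENNReal.ofReal (Z ω ^ 2) ∂P ≤ ENNReal.ofReal C := by
    refine le_trans (lintegral_mono fun ω => ?_) hDC
    rw [ENNReal.ofReal_pow ENNReal.toReal_nonneg]
    gcongr
    exact ENNReal.ofReal_toReal_le
  have hZ2 : MemLp Z 2 P := by
    rw [memLp_two_iff_integrable_sq hZm.aestronglyMeasurable]
    refine ⟨(hZm.pow_const 2).aestronglyMeasurable, ?_⟩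
    rw [hasFiniteIntegral_iff_ofReal (.of_forall fun ω => sq_nonneg _)]
    exact hsq.trans_lt ENNReal.ofReal_lt_top
  have hZC : ∫ ω, Z ω ^ 2 ∂P ≤ C := by
    rw [integral_eq_lintegral_of_nonneg_ae (.of_forall fun ω => sq_nonneg _)
      (hZm.pow_const 2).aestronglyMeasurable]
    exact ENNReal.toReal_le_of_le_ofReal hC.le hsq
  set x : ℝ := ∫ ω, X ω ∂P with hx
  have hY2 : MemLp (fun ω => X ω - x) 2 P := hX.sub (memLp_const _)
  have hdiff : ∫ ω, (X ω - x) * Z ω ∂P = ∫ ω, X ω ∂Q - x := by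
    have h1 : ∫ ω, X ω ∂Q - x = ∫ ω, (X ω - x) ∂Q := by
      rw [integral_sub hXQ (integrable_const _)]; simp
    rw [h1, hQ, integral_withDensity_eq_integral_toReal_smul hD hfin]
    simp only [smul_eq_mul, mul_comm, hZ]
  rw [← hdiff, variance_eq_integral hX.aestronglyMeasurable.aemeasurable]
  set d := ∫ ω, (X ω - x) * Z ω ∂P with hd
  -- Cauchy–Schwarz by expanding E(X - x - eZ)² ≥ 0; e = d / C is the optimal choice once E Z² is
  -- replaced by its bound C.
  have key : 0 ≤ ∫ ω, (X ω - x) ^ 2 ∂P - 2 * (d / C) * d + (d / C) ^ 2 * ∫ ω, Z ω ^ 2 ∂P := by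
    have i1 := hY2.integrable_sq
    have i2 : Integrable (fun ω => (X ω - x) * Z ω) P := hY2.integrable_mul hZ2
    have i3 := hZ2.integrable_sq
    have : ∫ ω, ((X ω - x) - d / C * Z ω) ^ 2 ∂P
        = ∫ ω, (X ω - x) ^ 2 ∂P - 2 * (d / C) * d + (d / C) ^ 2 * ∫ ω, Z ω ^ 2 ∂P := by
      generalize d / C = e
      have h : ∀ ω, ((X ω - x) - e * Z ω) ^ 2 =
          (X ω - x) ^ 2 - 2 * e * ((X ω - x) * Z ω) + e ^ 2 * Z ω ^ 2 := fun ω => by ring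
      simp_rw [h]
      rw [integral_add (by exact i1.sub (i2.const_mul _)) (i3.const_mul _),
        integral_sub i1 (i2.const_mul _), integral_const_mul, integral_const_mul, hd]
    rw [← this]
    exact integral_nonneg fun ω => sq_nonneg _
  have h2 : (d / C) ^ 2 * ∫ ω, Z ω ^ 2 ∂P ≤ (d / C) ^ 2 * C := by gcongr
  have h3 : 2 * (d / C) * d - (d / C) ^ 2 * C = d ^ 2 / C := by field_simp; ring
  have h4 : d ^ 2 / C ≤ ∫ ω, (X ω - x) ^ 2 ∂P := by linarith
  rw [div_le_iff₀ hC] at h4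
  linarith

/-! ### Likelihood ratio of bandit histories -/

lemma lintegral_historyLaw_succ (ν : Instance) (π : Policy ν.K) (t : ℕ)
    {f : History ν.K (t + 1) → ℝ≥0∞} (hf : Measurable f) :
    ∫⁻ h, f h ∂(historyLaw ν π (t + 1)) =
      ∫⁻ h, ∫⁻ a, ∫⁻ r, f (Fin.snoc h (a, r)) ∂(ν.arm a) ∂(π.rule t h) ∂(historyLaw ν π t) := by
  have hs := measurable_snoc ν.K t
  rw [historyLaw, lintegral_map hf hs, Measure.lintegral_compProd (by exact hf.comp hs)]
  refine lintegral_congr fun h => ?_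
  rw [Kernel.lintegral_compProd _ _ _
    (by exact (hf.comp hs).comp (measurable_const.prodMk measurable_id))]
  rfl

lemma measurable_lintegral_snoc (ν : Instance) (π : Policy ν.K) (t : ℕ)
    {f : History ν.K (t + 1) → ℝ≥0∞} (hf : Measurable f) :
    Measurable fun h => ∫⁻ a, ∫⁻ r, f (Fin.snoc h (a, r)) ∂(ν.arm a) ∂(π.rule t h) := by
  have h : Measurable fun y : History ν.K t × Fin ν.K =>
      ∫⁻ r, f (Fin.snoc y.1 (y.2, r)) ∂(ν.rewardKernel y.2) :=
    Measurable.lintegral_kernel_prod_right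
      (κ := ν.rewardKernel.comap (Prod.snd : History ν.K t × Fin ν.K → Fin ν.K) measurable_snd)
      ((hf.comp (measurable_snoc ν.K t)).comp ((measurable_fst.comp measurable_fst).prodMk
        ((measurable_snd.comp measurable_fst).prodMk measurable_snd)))
  exact Measurable.lintegral_kernel_prod_right (κ := π.rule t) h

lemma measurable_prod_density {K t : ℕ} {ℓ : Fin K → ℝ → ℝ≥0∞} (hℓ : ∀ i, Measurable (ℓ i)) :
    Measurable (fun h : History K t => ∏ s, ℓ (h s).1 (h s).2) := by
  have : Measurable (fun p : Fin K × ℝ => ℓ p.1 p.2) := measurable_from_prod_countable_right hℓ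
  exact Finset.measurable_prod _ fun s _ => this.comp (measurable_pi_apply s)

/-- Changing the reward distributions changes the law of the history by the product of the
densities of the observed rewards. -/
lemma historyLaw_eq_withDensity {K : ℕ} (hK : 2 ≤ K) {p q : Fin K → Measure ℝ}
    (hp : ∀ i, IsProbabilityMeasure (p i)) (hq : ∀ i, IsProbabilityMeasure (q i))
    {ℓ : Fin K → ℝ → ℝ≥0∞} (hℓ : ∀ i, Measurable (ℓ i)) (hpq : ∀ i, q i = (p i).withDensity (ℓ i))
    (π : Policy K) (t : ℕ) :
    historyLaw ⟨K, hK, q, hq⟩ π t =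
      (historyLaw ⟨K, hK, p, hp⟩ π t).withDensity fun h => ∏ s, ℓ (h s).1 (h s).2 := by
  have main : ∀ f : History K t → ℝ≥0∞, Measurable f →
      ∫⁻ h, f h ∂(historyLaw ⟨K, hK, q, hq⟩ π t) =
        ∫⁻ h, (∏ s, ℓ (h s).1 (h s).2) * f h ∂(historyLaw ⟨K, hK, p, hp⟩ π t) := by
    induction t with
    | zero => intro f hf; simp [historyLaw]
    | succ t ih =>
      intro f hf
      have hfs := hf.comp (measurable_snoc K t)
      -- The induction hypothesis is applied to `f` averaged over the last round. The decision rule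
      -- is the same on both sides, so only the reward contributes a density factor.
      rw [lintegral_historyLaw_succ _ _ _ hf,
        lintegral_historyLaw_succ _ _ _ ((measurable_prod_density hℓ).mul hf), ih]
      · refine lintegral_congr fun h => ?_
        rw [← lintegral_const_mul _ (measurable_of_finite _)]
        refine lintegral_congr fun a => ?_
        have hfa : Measurable fun r => f (Fin.snoc h (a, r)) :=
          hfs.comp (measurable_const.prodMk (measurable_const.prodMk measurable_id))
        rw [← lintegral_const_mul _ (by exact hfa)]
        simp only [hpq]
        rw [lintegral_withDensity_eq_lintegral_mul _ (hℓ a) (hfa.const_mul _)]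
        refine lintegral_congr fun r => ?_
        simp only [Pi.mul_apply, Fin.prod_univ_castSucc, Fin.snoc_castSucc, Fin.snoc_last]
        ring
      · exact measurable_lintegral_snoc ⟨K, hK, q, hq⟩ π t hf
  ext s hs
  rw [withDensity_apply _ hs, ← lintegral_indicator_one hs,
    main _ (measurable_one.indicator hs), ← lintegral_indicator hs]
  refine lintegral_congr fun h => ?_
  by_cases hh : h ∈ s <;> simp [hh]

/-- Given the past and the chosen arm, the last factor has second moment at most `c` whichever arm
it is. Integrating it out first makes the bound independent of the adaptive policy. -/
lemma lintegral_sq_prod_density_le {K : ℕ} (hK : 2 ≤ K) {p : Fin K → Measure ℝ}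
    (hp : ∀ i, IsProbabilityMeasure (p i)) {ℓ : Fin K → ℝ → ℝ≥0∞} (hℓ : ∀ i, Measurable (ℓ i))
    {c : ℝ≥0∞} (hc : ∀ i, ∫⁻ x, ℓ i x ^ 2 ∂(p i) ≤ c) (π : Policy K) (t : ℕ) :
    ∫⁻ h, (∏ s, ℓ (h s).1 (h s).2) ^ 2 ∂(historyLaw ⟨K, hK, p, hp⟩ π t) ≤ c ^ t := by
  induction t with
  | zero => simp
  | succ t ih =>
    rw [lintegral_historyLaw_succ _ _ _ ((measurable_prod_density hℓ).pow_const 2), pow_succ]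
    calc _ ≤ ∫⁻ h, (∏ s, ℓ (h s).1 (h s).2) ^ 2 * c ∂(historyLaw ⟨K, hK, p, hp⟩ π t) := by
          refine lintegral_mono fun h => ?_
          calc _ ≤ ∫⁻ a, (∏ s, ℓ (h s).1 (h s).2) ^ 2 * c ∂(π.rule t h) := by
                refine lintegral_mono fun a => ?_
                simp only [Fin.prod_univ_castSucc, Fin.snoc_castSucc, Fin.snoc_last, mul_pow]
                rw [lintegral_const_mul _ ((hℓ a).pow_const 2)]
                gcongr
                exact hc a
            _ = _ := by simp
      _ ≤ _ := by
          rw [lintegral_mul_const _ ((measurable_prod_density hℓ).pow_const 2)]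
          gcongr

/-! ### Gaussian instances -/

/-- The density of `gaussianReal m' v` with respect to `gaussianReal m v`. -/
noncomputable def gaussianRatio (m m' : ℝ) (v : ℝ≥0) (x : ℝ) : ℝ≥0∞ :=
  ENNReal.ofReal (Real.exp ((m' - m) * (x - m) / v - (m' - m) ^ 2 / (2 * v)))

lemma measurable_gaussianRatio (m m' : ℝ) (v : ℝ≥0) : Measurable (gaussianRatio m m' v) := by
  unfold gaussianRatio; fun_prop

lemma gaussianReal_eq_withDensity (m m' : ℝ) {v : ℝ≥0} (hv : v ≠ 0) :
    gaussianReal m' v = (gaussianReal m v).withDensity (gaussianRatio m m' v) := by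
  rw [gaussianReal_of_var_ne_zero _ hv, gaussianReal_of_var_ne_zero _ hv,
    ← withDensity_mul _ (measurable_gaussianPDF _ _) (measurable_gaussianRatio _ _ _)]
  congr with x
  have hv' : (v : ℝ) ≠ 0 := by exact_mod_cast hv
  simp only [Pi.mul_apply, gaussianPDF, gaussianRatio, gaussianPDFReal]
  rw [← ENNReal.ofReal_mul (by positivity), mul_assoc (√_)⁻¹, ← Real.exp_add]
  congr 3
  field_simp
  ring

/-- The squared ratio is a constant times the ratio for the doubled shift, with mean `2 * m' - m`,
and that ratio integrates to 1. -/
lemma lintegral_gaussianRatio_sq (m m' : ℝ) {v : ℝ≥0} (hv : v ≠ 0) :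
    ∫⁻ x, gaussianRatio m m' v x ^ 2 ∂(gaussianReal m v) =
      ENNReal.ofReal (Real.exp ((m' - m) ^ 2 / v)) := by
  have hv' : (v : ℝ) ≠ 0 := by exact_mod_cast hv
  have h1 : ∀ x, gaussianRatio m m' v x ^ 2 =
      ENNReal.ofReal (Real.exp ((m' - m) ^ 2 / v)) * gaussianRatio m (2 * m' - m) v x := by
    intro x
    unfold gaussianRatio
    rw [← ENNReal.ofReal_pow (by positivity), ← ENNReal.ofReal_mul (by positivity),
      ← Real.exp_nat_mul, ← Real.exp_add]
    congr 2
    push_cast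
    field_simp
    ring
  have h2 : ∫⁻ x, gaussianRatio m (2 * m' - m) v x ∂(gaussianReal m v) = 1 := by
    rw [← setLIntegral_univ, ← withDensity_apply _ .univ, ← gaussianReal_eq_withDensity _ _ hv,
      measure_univ]
  simp_rw [h1]
  rw [lintegral_const_mul _ (measurable_gaussianRatio _ _ _), h2, mul_one]

/-- The bandit instance with Gaussian rewards of common variance. -/
noncomputable abbrev gaussianInstance {K : ℕ} (hK : 2 ≤ K) (m : Fin K → ℝ) (v : ℝ≥0) : Instance :=
  ⟨K, hK, fun i => gaussianReal (m i) v, fun _ => inferInstance⟩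

lemma gaussianInstance_mean {K : ℕ} (hK : 2 ≤ K) (m : Fin K → ℝ) (v : ℝ≥0) (i : Fin K) :
    (gaussianInstance hK m v).mean i = m i := by
  simp only [Instance.mean]
  exact integral_id_gaussianReal

lemma hasSubgaussianMGF_gaussianReal (m : ℝ) (v : ℝ≥0) :
    HasSubgaussianMGF (fun x => x - m) v (gaussianReal m v) where
  integrable_exp_mul t := by
    simp_rw [mul_sub, Real.exp_sub]
    exact (integrable_exp_mul_gaussianReal t).div_const _
  mgf_le t := by
    rw [mgf_gaussianReal (gaussianReal_map_sub_const m)]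
    simp

lemma gaussianInstance_mem {K Kbar : ℕ} (hK : 2 ≤ K) (hKbar : K ≤ Kbar) {M : ℝ} {m : Fin K → ℝ}
    (hm : ∀ i, m i ∈ Set.Icc (-M) M) (σ : ℝ≥0) :
    gaussianInstance hK m (σ ^ 2) ∈ subGaussianClass M σ Kbar := by
  refine ⟨hKbar, fun i => ?_⟩
  change Fin K at i
  rw [gaussianInstance_mean]
  exact ⟨hm i, hasSubgaussianMGF_gaussianReal _ _⟩

lemma memLp_pullCount (π : Algorithm) (ν : Instance) (T : ℕ) (i : Fin ν.K) :
    MemLp (fun h => (pullCount i h : ℝ)) 2 (π.law ν T) :=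
  MemLp.of_bound (measurable_pullCount i).aestronglyMeasurable T
    (.of_forall fun h => by simpa using pullCount_le i h)

/-- Shifting the Gaussian means changes the expected number of pulls by little if the number of
pulls has a small variance. -/
lemma sq_expectedPulls_sub_le {K : ℕ} (hK : 2 ≤ K) (π : Algorithm) (T : ℕ) {m m' : Fin K → ℝ}
    {v : ℝ≥0} (hv : v ≠ 0) {d : ℝ} (hd : ∀ i, (m' i - m i) ^ 2 ≤ d) (i : Fin K) :
    (π.expectedPulls (gaussianInstance hK m' v) T i -
      π.expectedPulls (gaussianInstance hK m v) T i) ^ 2 ≤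
      Real.exp (T * (d / v)) *
        Var[fun h => (pullCount i h : ℝ); π.law (gaussianInstance hK m v) T] := by
  have hℓ : ∀ j, Measurable (gaussianRatio (m j) (m' j) v) :=
    fun j => measurable_gaussianRatio _ _ _
  have hdens : π.law (gaussianInstance hK m' v) T =
      (π.law (gaussianInstance hK m v) T).withDensity fun h => ∏ s, gaussianRatio (m (h s).1) (m' (h s).1) v (h s).2 :=
    historyLaw_eq_withDensity hK _ _ hℓ (fun j => gaussianReal_eq_withDensity _ _ hv) (π K hK T) T
  have hsq : ∫⁻ h, (∏ s, gaussianRatio (m (h s).1) (m' (h s).1) v (h s).2) ^ 2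
      ∂(π.law (gaussianInstance hK m v) T) ≤ ENNReal.ofReal (Real.exp (T * (d / v))) := by
    rw [Real.exp_nat_mul, ENNReal.ofReal_pow (Real.exp_pos _).le]
    refine lintegral_sq_prod_density_le hK _ hℓ (fun j => ?_) (π K hK T) T
    rw [lintegral_gaussianRatio_sq _ _ hv]
    gcongr
    exact hd j
  exact sq_integral_withDensity_sub_le (P := π.law (gaussianInstance hK m v) T)
    (Q := π.law (gaussianInstance hK m' v) T)
    (measurable_prod_density (ℓ := fun j => gaussianRatio (m j) (m' j) v) hℓ)
    hdens (Real.exp_pos _) hsq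
    (memLp_pullCount π (gaussianInstance hK m v) T i)
    (integrable_pullCount π (gaussianInstance hK m' v) T i)

/-! ### Bounds by the worst-case quantities -/

lemma variance_pullCount_le (π : Algorithm) {P : Set Instance} {ν : Instance} (hν : ν ∈ P) (T : ℕ)
    (i : Fin ν.K) :
    Var[fun h => (pullCount i h : ℝ); π.law ν T] ≤ π.worstVariability P T ^ 2 := by
  have h1 : √(Var[fun h => (pullCount i h : ℝ); π.law ν T]) ≤ π.worstVariability P T :=
    (le_ciSup (f := fun i : Fin ν.K => √(Var[fun h => (pullCount i h : ℝ); π.law ν T]))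
      (Set.finite_range _).bddAbove i).trans
      (le_ciSup (bddAbove_allocationVariability π P T) ⟨ν, hν⟩)
  rw [← Real.sq_sqrt (variance_nonneg _ _)]
  gcongr

lemma worstVariability_nonneg (π : Algorithm) (P : Set Instance) (T : ℕ) :
    0 ≤ π.worstVariability P T :=
  Real.iSup_nonneg fun _ => Real.iSup_nonneg fun _ => Real.sqrt_nonneg _

lemma worstVariability_le (π : Algorithm) (P : Set Instance) (T : ℕ) :
    π.worstVariability P T ≤ T := by
  refine Real.iSup_le (fun ν => Real.iSup_le (fun i => ?_) T.cast_nonneg) T.cast_nonneg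
  rw [Real.sqrt_le_left T.cast_nonneg]
  refine (variance_le_expectation_sq (measurable_pullCount i).aestronglyMeasurable).trans ?_
  calc _ ≤ ∫ h, (T : ℝ) ^ 2 ∂(π.law ν T) := by
        refine integral_mono_of_nonneg (.of_forall fun h => sq_nonneg _) (integrable_const _)
          (.of_forall fun h => ?_)
        have := pullCount_le i h
        simp only [Pi.pow_apply]
        gcongr
    _ = _ := by simp

lemma expectedPulls_nonneg (π : Algorithm) (ν : Instance) (T : ℕ) (i : Fin ν.K) :
    0 ≤ π.expectedPulls ν T i :=
  integral_nonneg fun _ => Nat.cast_nonneg _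

lemma gap_nonneg (ν : Instance) (i : Fin ν.K) : 0 ≤ ν.gap i :=
  sub_nonneg.2 (le_ciSup (Set.finite_range _).bddAbove i)

lemma gap_mul_expectedPulls_le_worstRegret (π : Algorithm) {M : ℝ} {σ : ℝ≥0} {Kbar : ℕ}
    {ν : Instance} (hν : ν ∈ subGaussianClass M σ Kbar) (T : ℕ) (i : Fin ν.K) :
    ν.gap i * π.expectedPulls ν T i ≤ π.worstRegret (subGaussianClass M σ Kbar) T :=
  (Finset.single_le_sum (f := fun i => ν.gap i * π.expectedPulls ν T i)
    (fun j _ => mul_nonneg (gap_nonneg ν j) (expectedPulls_nonneg π ν T j))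
    (Finset.mem_univ i)).trans (le_ciSup (bddAbove_regret π M σ Kbar T) ⟨ν, hν⟩)

/-! ### The chain of two-armed instances -/

/-- The two-armed Gaussian instance with variance `v` whose means are `x` and `0`. -/
noncomputable abbrev twoArmed (x : ℝ) (v : ℝ≥0) : Instance :=
  gaussianInstance le_rfl ![x, 0] v

/-- If the worst-case regret is at most `L * σ * √T / 4`, then the expected number of pulls of the
suboptimal arm decreases from `T / 2` to at most `T / 4` along a chain of `L` instances whose
consecutive members are statistically close, so that one of them has a large variability. -/
lemma natCast_le_mul_worstVariability {M : ℝ} (hM : 0 < M) {σ : ℝ≥0} (hσ : 0 < σ) {Kbar : ℕ}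
    (hK : 2 ≤ Kbar) (π : Algorithm) (hπ : π.IsRegular (subGaussianClass M σ Kbar)) {T L : ℕ}
    (hT : 2 ≤ T) (hL0 : 0 < L) (hLM : L * (σ / √T) ≤ M)
    (hR : 4 * π.worstRegret (subGaussianClass M σ Kbar) T ≤ L * σ * √T) :
    (T : ℝ) ≤ 8 * L * π.worstVariability (subGaussianClass M σ Kbar) T := by
  set P := subGaussianClass M σ Kbar
  set S := π.worstVariability P T
  have hS : 0 ≤ S := worstVariability_nonneg π P T
  have hT0 : (0 : ℝ) < T := by exact_mod_cast (by omega : 0 < T)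
  have hσ' : (0 : ℝ) < σ := hσ
  -- The scale at which T δ² / σ² = 1, so that T rounds barely distinguish neighbouring instances.
  set δ : ℝ := σ / √T with hδ
  have hδ0 : 0 < δ := by positivity
  have hv : (σ ^ 2 : ℝ≥0) ≠ 0 := by positivity
  have hmem : ∀ k ≤ L, twoArmed (k * δ) (σ ^ 2) ∈ P := fun k hk => by
    refine gaussianInstance_mem le_rfl hK (fun i => ?_) σ
    have h1 : (k : ℝ) * δ ≤ M := le_trans (by gcongr) hLM
    have h2 : 0 ≤ (k : ℝ) * δ := by positivity
    fin_cases i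
    · exact ⟨by simp; linarith, by simpa using h1⟩
    · exact ⟨by simp; linarith, by simpa using hM.le⟩
  set f : ℕ → ℝ := fun k => π.expectedPulls (twoArmed (k * δ) (σ ^ 2)) T (1 : Fin 2) with hf
  have hstart : f 0 = T / 2 := by
    have h0 := hmem 0 (Nat.zero_le _)
    have hs := hπ.symm _ h0 T hT (0 : Fin 2) (1 : Fin 2) (by simp)
    have hsum := sum_expectedPulls π (twoArmed ((0 : ℕ) * δ) (σ ^ 2)) T
    rw [Fin.sum_univ_two] at hsum
    simp only [hf]
    linarith
  have hend : f L ≤ T / 4 := by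
    have h1 := gap_mul_expectedPulls_le_worstRegret π (hmem L le_rfl) T (1 : Fin 2)
    have hgap : L * δ ≤ (twoArmed (L * δ) (σ ^ 2)).gap (1 : Fin 2) := by
      have h2 : (twoArmed (L * δ) (σ ^ 2)).mean (0 : Fin 2) = L * δ := gaussianInstance_mean _ _ _ _
      have h3 : (twoArmed (L * δ) (σ ^ 2)).mean (1 : Fin 2) = 0 := gaussianInstance_mean _ _ _ _
      have h4 : (twoArmed (L * δ) (σ ^ 2)).mean (0 : Fin 2) ≤ (twoArmed (L * δ) (σ ^ 2)).bestMean :=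
        le_ciSup (f := (twoArmed (L * δ) (σ ^ 2)).mean) (Set.finite_range _).bddAbove (0 : Fin 2)
      rw [Instance.gap]
      linarith
    -- Since σ√T = δT, the regret hypothesis reads 4R ≤ LδT, and the gap Lδ cancels.
    have h5 : L * δ * f L ≤ π.worstRegret P T :=
      (mul_le_mul_of_nonneg_right hgap (expectedPulls_nonneg π _ T _)).trans h1
    have h6 : L * σ * √T = L * δ * T := by
      rw [hδ]
      nth_rewrite 3 [← Real.mul_self_sqrt hT0.le]
      field_simp
    have h7 : 0 < L * δ := by positivity
    have h8 : L * δ * (4 * f L) ≤ L * δ * T := by linarith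
    linarith [le_of_mul_le_mul_left h8 h7]
  have hstep : ∀ k ∈ Finset.range L, f k - f (k + 1) ≤ 2 * S := fun k hk => by
    have hd : ∀ i : Fin 2,
        ((![((k + 1 : ℕ) : ℝ) * δ, 0] : Fin 2 → ℝ) i - (![k * δ, 0] : Fin 2 → ℝ) i) ^ 2 ≤ δ ^ 2 := by
      intro i
      fin_cases i
      · simp only [Fin.zero_eta, Matrix.cons_val_zero]
        push_cast
        exact le_of_eq (by ring)
      · simp; positivity
    have h1 := sq_expectedPulls_sub_le le_rfl π T hv hd (1 : Fin 2)
    have h2 := variance_pullCount_le π (hmem k (Finset.mem_range.1 hk).le) T (1 : Fin 2)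
    have h3 : (T : ℝ) * (δ ^ 2 / (σ ^ 2 : ℝ≥0)) = 1 := by
      rw [hδ, div_pow, Real.sq_sqrt hT0.le]
      push_cast
      field_simp
    rw [h3] at h1
    -- Rounding e up to 4 gives a clean square root.
    have h4 : (f (k + 1) - f k) ^ 2 ≤ (2 * S) ^ 2 := by
      calc (f (k + 1) - f k) ^ 2 ≤ Real.exp 1 * S ^ 2 := h1.trans (by gcongr)
        _ ≤ 4 * S ^ 2 := by gcongr; linarith [Real.exp_one_lt_d9]
        _ = _ := by ring
    linarith [neg_le_of_abs_le (abs_le_of_sq_le_sq h4 (by positivity))]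
  have hsum : f 0 - f L ≤ L * (2 * S) := by
    rw [← Finset.sum_range_sub']
    simpa using Finset.sum_le_card_nsmul _ _ _ hstep
  linarith

/-! ### Asymptotics -/

lemma eventually_mul_log_pow_le_sqrt (k : ℕ) {B : ℝ} (hB : 0 < B) :
    ∀ᶠ T : ℕ in atTop, B * Real.log T ^ k ≤ √(T : ℝ) := by
  have h := (isLittleO_log_rpow_rpow_atTop (k : ℝ) (one_half_pos (α := ℝ))).bound
    (inv_pos.2 hB)
  filter_upwards [tendsto_natCast_atTop_atTop.eventually h, eventually_ge_atTop 1] with T hT hT1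
  have hlog : 0 ≤ Real.log T := Real.log_natCast_nonneg T
  rw [Real.rpow_natCast, ← Real.sqrt_eq_rpow, Real.norm_of_nonneg (by positivity),
    Real.norm_of_nonneg (by positivity), inv_mul_eq_div, le_div_iff₀ hB] at hT
  linarith

/-- The chain length is proportional to the logarithmic factor in the regret, so exactly that factor
is lost; `k = 0` loses only a constant. -/
lemma isBigO_worstVariability {M : ℝ} (hM : 0 < M) {σ : ℝ≥0} (hσ : 0 < σ) {Kbar : ℕ}
    (hK : 2 ≤ Kbar) (π : Algorithm) (hπ : π.IsRegular (subGaussianClass M σ Kbar)) (k : ℕ)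
    (hR : (fun T : ℕ => π.worstRegret (subGaussianClass M σ Kbar) T) =O[atTop]
      fun T : ℕ => √(T : ℝ) * Real.log T ^ k) :
    (fun T : ℕ => (T : ℝ)) =O[atTop]
      fun T : ℕ => π.worstVariability (subGaussianClass M σ Kbar) T * Real.log T ^ k := by
  obtain ⟨C, hC, hR⟩ := hR.exists_pos
  have hσ' : (0 : ℝ) < σ := hσ
  -- The 2 absorbs the ceiling and the extra 1 in `L`, as `ℓ` is at least 1.
  set B : ℝ := 4 * C / σ + 2 with hB
  have hB0 : 0 < B := by positivity
  refine IsBigO.of_bound (8 * B) ?_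
  -- T ≥ 3 makes log T ≥ 1; the comparison with √T keeps the top mean Lσ/√T below M.
  filter_upwards [hR.bound, eventually_ge_atTop 3,
    eventually_mul_log_pow_le_sqrt k (B := B * σ / M) (by positivity)] with T hRT hT hsqrt
  have hT3 : (3 : ℝ) ≤ T := by exact_mod_cast hT
  have hlog : 1 ≤ Real.log T := by
    rw [Real.le_log_iff_exp_le (by linarith)]
    linarith [Real.exp_one_lt_d9]
  set ℓ := Real.log T ^ k with hℓ
  have hℓ1 : 1 ≤ ℓ := one_le_pow₀ hlog
  have hS := worstVariability_nonneg π (subGaussianClass M σ Kbar) T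
  have hs : 0 < √(T : ℝ) := Real.sqrt_pos.2 (by linarith)
  -- Long enough that 4C√T ℓ ≤ Lσ√T, with the 1 added to make `L` positive.
  set L : ℕ := ⌈4 * C * ℓ / σ⌉₊ + 1 with hL
  have hL1 : 4 * C * ℓ / σ ≤ L := (Nat.le_ceil _).trans (by simp [hL])
  have hL2 : (L : ℝ) ≤ B * ℓ := by
    have h1 := (Nat.ceil_lt_add_one (a := 4 * C * ℓ / σ) (by positivity)).le
    have h2 : B * ℓ = 4 * C * ℓ / σ + 2 * ℓ := by rw [hB]; ring
    rw [hL]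
    push_cast
    linarith
  have hLM : L * (σ / √T) ≤ M := by
    have h1 : B * σ * ℓ / M ≤ √T := by rwa [mul_div_right_comm]
    rw [div_le_iff₀ hM] at h1
    rw [← mul_div_assoc, div_le_iff₀ hs]
    calc (L : ℝ) * σ ≤ B * ℓ * σ := by gcongr
      _ ≤ M * √T := by linarith
  have hreg : 4 * π.worstRegret (subGaussianClass M σ Kbar) T ≤ L * σ * √T := by
    rw [Real.norm_of_nonneg (by positivity : 0 ≤ √(T : ℝ) * ℓ)] at hRT
    rw [div_le_iff₀ hσ'] at hL1
    calc _ ≤ 4 * (C * (√T * ℓ)) := by gcongr; exact (Real.le_norm_self _).trans hRT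
      _ = 4 * C * ℓ * √T := by ring
      _ ≤ _ := by gcongr
  have hmain := natCast_le_mul_worstVariability hM hσ hK π hπ (by omega) (Nat.succ_pos _) hLM hreg
  rw [Real.norm_of_nonneg (by positivity), Real.norm_of_nonneg (by positivity)]
  calc (T : ℝ) ≤ 8 * L * π.worstVariability (subGaussianClass M σ Kbar) T := hmain
    _ ≤ 8 * (B * ℓ) * π.worstVariability (subGaussianClass M σ Kbar) T := by gcongr
    _ = _ := by ring

lemma worstVariability_isBigO (π : Algorithm) (P : Set Instance) :
    (fun T : ℕ => π.worstVariability P T) =O[atTop] fun T : ℕ => (T : ℝ) :=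
  IsBigO.of_bound 1 <| .of_forall fun T => by
    rw [Real.norm_of_nonneg (worstVariability_nonneg π P T), Real.norm_of_nonneg T.cast_nonneg,
      one_mul]
    exact worstVariability_le π P T

end Bandit

theorem corollary1 (M : ℝ) (hM : 0 < M) (σ : ℝ≥0) (hσ : 0 < σ) (Kbar : ℕ) (hK : 2 ≤ Kbar)
    (π : Bandit.Algorithm) (hπ : π.IsRegular (Bandit.subGaussianClass M σ Kbar)) :
    (Bandit.SoftO (fun T => π.worstRegret (Bandit.subGaussianClass M σ Kbar) T)
        (fun T => √(T : ℝ)) →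
      Bandit.SoftTheta (fun T => π.worstVariability (Bandit.subGaussianClass M σ Kbar) T)
        (fun T => (T : ℝ))) ∧
    ((fun T : ℕ => π.worstRegret (Bandit.subGaussianClass M σ Kbar) T)
        =Θ[atTop] (fun T : ℕ => √(T : ℝ)) →
      (fun T : ℕ => π.worstVariability (Bandit.subGaussianClass M σ Kbar) T)
        =Θ[atTop] (fun T : ℕ => (T : ℝ))) := by
  refine ⟨fun ⟨k, hR⟩ => ⟨⟨0, ?_⟩, k, Bandit.isBigO_worstVariability hM hσ hK π hπ k hR⟩,
    fun hR => ⟨Bandit.worstVariability_isBigO π _, ?_⟩⟩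
  · simpa using Bandit.worstVariability_isBigO π (Bandit.subGaussianClass M σ Kbar)
  · simpa using Bandit.isBigO_worstVariability hM hσ hK π hπ 0 (by simpa using hR.1)
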